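/- Let $(X,d)$ be a bounded metric space with its Borel $\sigma$-algebra and a Borel probability measure $m$, and let $T:X\to X$ be a measurable map preserving $m$. Suppose that $T$ is Gibbs–Markov for $\alpha$, that is, $\alpha$ is a partition of $X$ (modulo $0$) into measurable sets of positive measure such that: (1) for every $a\in\alpha$, $T(a)$ is (modulo $0$) a union of elements of $\alpha$, and $T:a\to T(a)$ is invertible and non singular (injective, with measurable inverse, and mapping null subsets of $a$ to null sets); (2) there is a finite subset $\{a_1,\dots,a_n\}$ of $\alpha$ such that for every $a\in\alpha$ there are $i,j$ with $a\subset T(a_i)$ and $a_j\subset T(a)$ (modulo $0$); (3) there is $\lambda>1$ such that for every $a\in\alpha$, $d(Tx,Ty)\ge\lambda d(x,y)$ for almost all $x,y\in a$; (4) there is $C_0$ such that for every $a\in\alpha$, with $g=\frac{\mathrm{d}m_{|a}}{\mathrm{d}(m\circ T_{|a})}$ on $a$, $\left|1-\frac{g(x)}{g(y)}\right|\le C_0\,d(Tx,Ty)$ for almost all $x,y\in a$. Here "for almost all $x,y\in a$" means for all $x,y\in\Omega$, for some $\Omega\subset a$ with $m(a\setminus\Omega)=0$. For a map $h$ from $X$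 to an abelian group $G$ with invariant metric $|x-y|$ and for $Z\subset X$, let $Dh(Z)\in[0,\infty]$ be the infimum of the $C>0$ for which there is $\Omega\subset Z$ with $m(Z\setminus\Omega)=0$ and $|h(x)-h(y)|\le C\,d(x,y)$ for all $x,y\in\Omega$. Let $\alpha_*$ be the partition of $X$ generated by the sets $T(a)$, $a\in\alpha$. Then there is a finite constant $C$, depending only on $(X,d,m,T,\alpha)$, such that the following holds. Let $G$ be a locally compact abelian group whose topology is given by an invariant metric $|x-y|$, let $f:X\to G$ satisfy $\sum_{a\in\alpha}m(a)Df(a)<\infty$, and let $u:X\to G$ be a measurable function with $f=u-u\circ T$ almost everywhere. Then $$\sup_{a_*\in\alpha_*}Du(a_*)<\infty,\qquad \sup_{a_*\in\alpha_*}Du(a_*)\le C\sum_{a\in\alpha}m(a)Df(a),$$ and $u$ is essentially bounded. -/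

import Mathlib

open MeasureTheory Set
open scoped ENNReal NNReal

noncomputable section

/-- The essential Lipschitz constant `D f(Z)`, with value `∞` if there is no admissible constant. -/
def essLip {X G : Type*} [MetricSpace X] [MeasurableSpace X] [MetricSpace G]
    (m : Measure X) (f : X → G) (Z : Set X) : ℝ≥0∞ :=
  sInf {D : ℝ≥0∞ | ∃ c : ℝ, 0 < c ∧ D = ENNReal.ofReal c ∧
    ∃ Ω ⊆ Z, m (Z \ Ω) = 0 ∧ ∀ x ∈ Ω, ∀ y ∈ Ω, dist (f x) (f y) ≤ c * dist x y}

/-- The measure `m ∘ T|ₐ`, i.e. `Z ↦ m (T (Z ∩ a))`, for a map `T` that is injective on `a` and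
sends measurable subsets of `a` to (null-)measurable sets. -/
def branchMeasure {X : Type*} [MeasurableSpace X] (m : Measure X) (T : X → X) (a : Set X) :
    Measure X :=
  (m.comap fun x : a => T x).map Subtype.val

/-- The inverse of the jacobian of `T` on `a`: the density of `m|ₐ` with respect to `m ∘ T|ₐ`. -/
def invJacobian {X : Type*} [MeasurableSpace X] (m : Measure X) (T : X → X) (a : Set X) (x : X) :
    ℝ :=
  ((m.restrict a).rnDeriv (branchMeasure m T a) x).toReal

/-- `T` is a Gibbs–Markov map with respect to the partition `α`. -/
structure IsGibbsMarkov {X : Type*} [MetricSpace X] [MeasurableSpace X]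
    (m : Measure X) (T : X → X) (α : Set (Set X)) : Prop where
  /-- `T` is measurable and non singular. -/
  measurable_map : Measurable T
  nonsingular : ∀ Z, MeasurableSet Z → (m (T ⁻¹' Z) = 0 ↔ m Z = 0)
  /-- `α` is a partition of the space modulo `0`, by measurable sets of positive measure. -/
  measurableSet : ∀ a ∈ α, MeasurableSet a
  measure_pos : ∀ a ∈ α, 0 < m a
  aedisjoint : α.Pairwise (AEDisjoint m)
  cover : m (⋃₀ α)ᶜ = 0
  /-- `T(a)` is a union, modulo `0`, of elements of `α`. -/
  markov : ∀ a ∈ α, ∃ β ⊆ α, T '' a =ᵐ[m] ⋃₀ β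
  /-- `T : a → T(a)` is an invertible non singular map: it is injective, its inverse is measurable
  and its inverse is non singular. -/
  injOn : ∀ a ∈ α, InjOn T a
  nullMeasurableSet_image : ∀ a ∈ α, ∀ Z ⊆ a, MeasurableSet Z → NullMeasurableSet (T '' Z) m
  null_image : ∀ a ∈ α, ∀ Z ⊆ a, m Z = 0 → m (T '' Z) = 0
  /-- Big images and preimages. -/
  bip : ∃ s : Set (Set X), s ⊆ α ∧ s.Finite ∧
    ∀ a ∈ α, (∃ b ∈ s, m (a \ T '' b) = 0) ∧ (∃ b ∈ s, m (b \ T '' a) = 0)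
  /-- Expansion. -/
  expansion : ∃ l : ℝ, 1 < l ∧ ∀ a ∈ α, ∃ Ω ⊆ a, m (a \ Ω) = 0 ∧
    ∀ x ∈ Ω, ∀ y ∈ Ω, l * dist x y ≤ dist (T x) (T y)
  /-- Distortion. -/
  distortion : ∃ C : ℝ, ∀ a ∈ α, ∃ Ω ⊆ a, m (a \ Ω) = 0 ∧
    ∀ x ∈ Ω, ∀ y ∈ Ω,
      |1 - invJacobian m T a x / invJacobian m T a y| ≤ C * dist (T x) (T y)

/-- The partition `α_*` generated by the images `T(a)`, `a ∈ α`: two points are in the same element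
if and only if they belong to the same images. -/
def imagePartition {X : Type*} (T : X → X) (α : Set (Set X)) : Set (Set X) :=
  range fun x : X => {y : X | ∀ a ∈ α, y ∈ T '' a ↔ x ∈ T '' a}

end

/-! ### The essential Lipschitz constant. -/

section EssLip

variable {X G : Type*} [MetricSpace X] [MeasurableSpace X] [MetricSpace G] {m : Measure X}
  {f : X → G} {Z : Set X}

/-! Regularity of `u` is carried from small scale to large scale by the dynamics. Fix `b ∈ α` and
let `c` be a cylinder of length `n + 1` and positive measure whose last letter is `b`. By the Markov
property `T^[n + 1]` maps `c` onto `T '' b` modulo `0`. Iterating `u ∘ T = u - f`, two points of `c`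
satisfy `|u(T^(n+1) x) - u(T^(n+1) y)| ≤ |u x - u y| + (∑ ρ^(n+1-k) Df(w k)) d(T^(n+1) x, T^(n+1)
y)`. If `u` is within `ε` of a constant on all of `c` except a proportion `δ`, bounded distortion
(`exists_measure_image_mul_le`) makes the image of the exceptional set have measure `O(δ)`.
Borel–Cantelli along `ε = δ = 2^(-j)` then gives the Lipschitz bound almost everywhere on `T '' b`
(`exists_essLip_image_le`).

Such cylinders come from `exists_wordCylinder`. Markov's inequality for the discounted sum, whose
integral is controlled by invariance of `m`, leaves at least half of `T^(-n) b` with a controlled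
sum. On the other hand `u` is nearly constant on each of finitely many closed sets covering most of
`X`; long cylinders have small diameter, so those meeting a closed set stay in a thin thickening of
it, and some cylinder lies mostly inside.

The covering needs `u` to be almost separably valued, although `G` need not be separable. Modulo the
open separable subgroup `H` generated by a compact neighbourhood of `0` and the essential range of
`f`, `u` is `T`-invariant. Applied to a real coding of `u` mod `H`, the regularity result with `f =
0` shows that this class is constant on each image, so countably many cosets of `H` suffice.
Finally, finitely many images cover `X`, which makes the constant uniform and `u` bounded. -/

theorem essLip_le {Ω : Set X} (hΩ : Ω ⊆ Z) (h0 : m (Z \ Ω) = 0) {K : ℝ≥0∞}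
    (h : ∀ x ∈ Ω, ∀ y ∈ Ω, edist (f x) (f y) ≤ K * edist x y) : essLip m f Z ≤ K := by
  -- Admissible constants are positive and finite while `K` may be `0` or `∞`, so `K` is approached
  -- from above.
  refine le_of_forall_gt fun b hb => ?_
  obtain ⟨c, hKc, hcb⟩ := exists_between hb
  have hc : c ≠ ∞ := hcb.ne_top
  refine lt_of_le_of_lt (sInf_le ⟨c.toReal, ENNReal.toReal_pos (pos_of_gt hKc).ne' hc,
    rfl, Ω, hΩ, h0, fun x hx y hy => ?_⟩) (by rwa [ENNReal.ofReal_toReal hc])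
  have h1 : edist (f x) (f y) ≤ c * edist x y := (h x hx y hy).trans (by gcongr)
  rw [edist_dist, edist_dist, ← ENNReal.ofReal_toReal hc,
    ← ENNReal.ofReal_mul ENNReal.toReal_nonneg] at h1
  exact (ENNReal.ofReal_le_ofReal_iff (by positivity)).1 h1

/-- The infimum is attained: intersect the good sets for the constants `essLip m f Z + 1/q`, a
countable family, and let `q → ∞`. -/
theorem exists_edist_le_essLip (hL : essLip m f Z ≠ ∞) :
    ∃ Ω ⊆ Z, m (Z \ Ω) = 0 ∧
      ∀ x ∈ Ω, ∀ y ∈ Ω, edist (f x) (f y) ≤ essLip m f Z * edist x y := by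
  have key : ∀ q : ℕ, ∃ Ω ⊆ Z, m (Z \ Ω) = 0 ∧ ∀ x ∈ Ω, ∀ y ∈ Ω,
      edist (f x) (f y) ≤ (essLip m f Z + (q : ℝ≥0∞)⁻¹) * edist x y := by
    intro q
    have hlt : essLip m f Z < essLip m f Z + (q : ℝ≥0∞)⁻¹ :=
      ENNReal.lt_add_right hL (by simp)
    obtain ⟨D, ⟨c, hc, rfl, Ω, hΩ, h0, h⟩, hD⟩ := sInf_lt_iff.1 hlt
    refine ⟨Ω, hΩ, h0, fun x hx y hy => ?_⟩
    refine le_trans ?_ (mul_le_mul_left hD.le _)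
    rw [edist_dist, edist_dist, ← ENNReal.ofReal_mul hc.le]
    exact ENNReal.ofReal_le_ofReal (h x hx y hy)
  choose Ω hΩ h0 h using key
  refine ⟨⋂ q, Ω q, (iInter_subset _ 0).trans (hΩ 0), ?_, fun x hx y hy => ?_⟩
  · rw [sdiff_iInter]
    exact measure_iUnion_null h0
  · have ht : Filter.Tendsto (fun q : ℕ => (essLip m f Z + (q : ℝ≥0∞)⁻¹) * edist x y)
        Filter.atTop (nhds ((essLip m f Z + 0) * edist x y)) :=
      ENNReal.Tendsto.mul_const (tendsto_const_nhds.add ENNReal.tendsto_inv_nat_nhds_zero)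
        (Or.inr (edist_ne_top x y))
    rw [add_zero] at ht
    exact ge_of_tendsto' ht fun q => h q x (mem_iInter.1 hx q) y (mem_iInter.1 hy q)

theorem essLip_mono {Z' : Set X} (hZ : Z ⊆ Z') : essLip m f Z ≤ essLip m f Z' := by
  rcases eq_or_ne (essLip m f Z') ∞ with h | h
  · simp [h]
  obtain ⟨Ω, -, h0, hl⟩ := exists_edist_le_essLip h
  refine essLip_le (Ω := Ω ∩ Z) inter_subset_right ?_ fun x hx y hy => hl x hx.1 y hy.1
  refine measure_mono_null ?_ h0
  rintro x ⟨hx, hx'⟩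
  exact ⟨hZ hx, fun hxΩ => hx' ⟨hxΩ, hx⟩⟩

theorem essLip_eq_zero_of_null (hZ : m Z = 0) : essLip m f Z = 0 :=
  le_antisymm (essLip_le (Ω := ∅) (empty_subset _) (by simpa using hZ) (by simp)) bot_le

end EssLip

/-! ### Cylinders and their images. -/

section Cylinder

variable {X : Type*} {T : X → X}

/-- The points whose first `n` iterates follow the word `w`. -/
def wordCylinder (T : X → X) (w : ℕ → Set X) (n : ℕ) : Set X := {x | ∀ k < n, T^[k] x ∈ w k}

theorem mem_wordCylinder_succ {w : ℕ → Set X} {n : ℕ} {x : X} :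
    x ∈ wordCylinder T w (n + 1) ↔ x ∈ w 0 ∧ T x ∈ wordCylinder T (fun k => w (k + 1)) n := by
  refine ⟨fun h => ⟨h 0 n.succ_pos, fun k hk => ?_⟩, fun h k hk => ?_⟩
  · have := h (k + 1) (by omega)
    rwa [Function.iterate_succ_apply] at this
  · cases k with
    | zero => exact h.1
    | succ k => exact h.2 k (by omega)

theorem measurableSet_wordCylinder [MeasurableSpace X] (hT : Measurable T) {w : ℕ → Set X}
    (hw : ∀ k, MeasurableSet (w k)) (n : ℕ) : MeasurableSet (wordCylinder T w n) := by
  have : wordCylinder T w n = ⋂ k, ⋂ (_ : k < n), T^[k] ⁻¹' w k := by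
    ext x; simp [wordCylinder]
  rw [this]
  exact .iInter fun k => .iInter fun _ => (hT.iterate k) (hw k)

end Cylinder

namespace IsGibbsMarkov

variable {X : Type*} [MetricSpace X] [MeasurableSpace X] {m : Measure X} {T : X → X}
  {α : Set (Set X)}

theorem quasiMeasurePreserving (hT : IsGibbsMarkov m T α) :
    Measure.QuasiMeasurePreserving T m m :=
  ⟨hT.measurable_map, Measure.AbsolutelyContinuous.mk fun Z hZ h => by
    rw [Measure.map_apply hT.measurable_map hZ]; exact (hT.nonsingular Z hZ).2 h⟩

theorem ae_iterate (hT : IsGibbsMarkov m T α) {p : X → Prop} (hp : ∀ᵐ x ∂m, p x) :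
    ∀ᵐ x ∂m, ∀ k : ℕ, p (T^[k] x) :=
  ae_all_iff.2 fun k => (hT.quasiMeasurePreserving.iterate k).ae hp

theorem countable [IsFiniteMeasure m] (hT : IsGibbsMarkov m T α) : α.Countable := by
  have h := Measure.countable_meas_pos_of_disjoint_iUnion₀ (μ := m) (As := fun a : α => (a : Set X))
    (fun a => (hT.measurableSet a a.2).nullMeasurableSet)
    (fun a b hab => hT.aedisjoint a.2 b.2 (fun h => hab (Subtype.ext h)))
  have : {a : α | 0 < m (a : Set X)} = univ := eq_univ_of_forall fun a => hT.measure_pos a a.2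
  rw [this] at h
  exact countable_coe_iff.1 (countable_univ_iff.1 h)

theorem ae_exists_mem (hT : IsGibbsMarkov m T α) : ∀ᵐ x ∂m, ∃ a ∈ α, x ∈ a := by
  filter_upwards [measure_eq_zero_iff_ae_notMem.1 hT.cover] with x hx
  simpa using hx

theorem ae_mem_of_mem [IsFiniteMeasure m] (hT : IsGibbsMarkov m T α) {Ω : Set X → Set X}
    (hΩ : ∀ a ∈ α, m (a \ Ω a) = 0) : ∀ᵐ x ∂m, ∀ a ∈ α, x ∈ a → x ∈ Ω a := by
  refine (ae_ball_iff hT.countable).2 fun a ha => ?_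
  filter_upwards [measure_eq_zero_iff_ae_notMem.1 (hΩ a ha)] with x hx hxa
  by_contra h
  exact hx ⟨hxa, h⟩

/-- Forward images of null sets are controlled only inside an element of `α`; staying in a cylinder
allows this control to be used at each step. -/
theorem measure_image_iterate_eq_zero (hT : IsGibbsMarkov m T α) (n : ℕ) {w : ℕ → Set X}
    (hw : ∀ k, w k ∈ α) {Z : Set X} (hZ : Z ⊆ wordCylinder T w n) (h0 : m Z = 0) :
    m (T^[n] '' Z) = 0 := by
  induction n generalizing w Z with
  | zero => simpa using h0
  | succ n ih =>
    rw [Function.iterate_succ, image_comp]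
    refine ih (w := fun k => w (k + 1)) (fun k => hw _) ?_
      (hT.null_image _ (hw 0) Z (fun x hx => (mem_wordCylinder_succ.1 (hZ hx)).1) h0)
    rintro _ ⟨x, hx, rfl⟩
    exact (mem_wordCylinder_succ.1 (hZ hx)).2

/-- A set of the partition is, modulo `0`, contained in or disjoint from the image of another. -/
theorem measure_inter_image_eq_zero_or [IsFiniteMeasure m] (hT : IsGibbsMarkov m T α)
    {a b : Set X} (ha : a ∈ α) (hb : b ∈ α) : m (b ∩ T '' a) = 0 ∨ m (b \ T '' a) = 0 := by
  obtain ⟨β, hβ, h⟩ := hT.markov a ha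
  by_cases hbβ : b ∈ β
  · right
    refine measure_mono_null (t := ⋃₀ β \ T '' a) (sdiff_subset_sdiff_left (subset_sUnion_of_mem hbβ))
      (ae_le_set.1 h.symm.le)
  · left
    have : m (b ∩ ⋃₀ β) = 0 := by
      rw [sUnion_eq_biUnion, inter_iUnion₂]
      refine (measure_biUnion_null_iff (hT.countable.mono hβ)).2 fun c hc => ?_
      exact hT.aedisjoint hb (hβ hc) fun hbc => hbβ (hbc ▸ hc)
    rw [← this]
    exact measure_congr (Filter.EventuallyEq.rfl.inter h)

/-- The image of a cylinder of positive measure is the image of its last letter, modulo `0`. -/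
theorem measure_image_diff_image_cylinder [IsFiniteMeasure m] (hT : IsGibbsMarkov m T α) (n : ℕ)
    {w : ℕ → Set X} (hw : ∀ k, w k ∈ α) (hpos : m (wordCylinder T w (n + 1)) ≠ 0) :
    m (T '' w n \ T^[n + 1] '' wordCylinder T w (n + 1)) = 0 := by
  induction n generalizing w with
  | zero =>
    have : wordCylinder T w 1 = w 0 := by ext x; simp [wordCylinder]
    simp [this]
  | succ n ih =>
    set v : ℕ → Set X := fun k => w (k + 1) with hv
    have hvα : ∀ k, v k ∈ α := fun k => hw _
    have himg : T '' wordCylinder T w (n + 2) = T '' w 0 ∩ wordCylinder T v (n + 1) := by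
      ext y
      constructor
      · rintro ⟨x, hx, rfl⟩
        exact ⟨⟨x, (mem_wordCylinder_succ.1 hx).1, rfl⟩, (mem_wordCylinder_succ.1 hx).2⟩
      · rintro ⟨⟨x, hx, rfl⟩, hy⟩
        exact ⟨x, mem_wordCylinder_succ.2 ⟨hx, hy⟩, rfl⟩
    have hne : m (T '' w 0 ∩ wordCylinder T v (n + 1)) ≠ 0 := by
      intro h0
      rw [← himg] at h0
      exact hpos (measure_mono_null (subset_preimage_image T _)
        (hT.quasiMeasurePreserving.preimage_null h0))
    have hsub : wordCylinder T v (n + 1) ⊆ v 0 := fun x hx => hx 0 n.succ_pos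
    -- `v 0` meets `T '' w 0` in positive measure, and the Markov property promotes this to
    -- inclusion modulo `0`.
    have h1 : m (v 0 \ T '' w 0) = 0 := by
      refine (hT.measure_inter_image_eq_zero_or (hw 0) (hw 1)).resolve_left fun h0 => hne ?_
      exact measure_mono_null (t := v 0 ∩ T '' w 0) (fun x hx => ⟨hsub hx.2, hx.1⟩) h0
    have h2 := ih hvα (fun h0 => hne (measure_mono_null inter_subset_right h0))
    -- The points of the shifted cylinder lost by applying `T` to the full one form a null set, and
    -- stay negligible under the iterate.
    have h3 : m (T^[n + 1] '' (wordCylinder T v (n + 1) \ T '' w 0)) = 0 :=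
      hT.measure_image_iterate_eq_zero (n + 1) hvα sdiff_subset
        (measure_mono_null (sdiff_subset_sdiff_left hsub) h1)
    refine measure_mono_null ?_ (measure_union_null h2 h3)
    rintro y ⟨hy, hy'⟩
    by_cases hyc : y ∈ T^[n + 1] '' wordCylinder T v (n + 1)
    · right
      obtain ⟨x, hx, rfl⟩ := hyc
      refine ⟨x, ⟨hx, fun hxa => hy' ?_⟩, rfl⟩
      have hxi : x ∈ T '' wordCylinder T w (n + 2) := by rw [himg]; exact ⟨hxa, hx⟩
      obtain ⟨z, hz, rfl⟩ := hxi
      exact ⟨z, hz, by rw [Function.iterate_succ_apply]⟩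
    · exact Or.inl ⟨hy, hyc⟩

end IsGibbsMarkov

/-! ### Contraction, jacobians and bounded distortion. -/

namespace IsGibbsMarkov

variable {X : Type*} [MetricSpace X] [MeasurableSpace X] {m : Measure X} {T : X → X}
  {α : Set (Set X)}

/-- Inverse branches contract uniformly along cylinders, on a set of full measure. -/
theorem exists_contraction [IsFiniteMeasure m] (hT : IsGibbsMarkov m T α) :
    ∃ ρ : ℝ≥0, ρ < 1 ∧ ∃ Y : Set X, (∀ᵐ x ∂m, x ∈ Y) ∧ ∀ (w : ℕ → Set X), (∀ k, w k ∈ α) →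
      ∀ n, ∀ x ∈ Y ∩ wordCylinder T w n, ∀ y ∈ Y ∩ wordCylinder T w n, ∀ k ≤ n,
        edist (T^[k] x) (T^[k] y) ≤ (ρ : ℝ≥0∞) ^ (n - k) * edist (T^[n] x) (T^[n] y) := by
  obtain ⟨l, hl, h⟩ := hT.expansion
  choose! Ω hΩa hΩ0 hΩ using h
  have hl' : (0 : ℝ) ≤ l⁻¹ := by positivity
  -- `Y` consists of the points whose whole orbit avoids the exceptional sets, so that expansion
  -- applies at every time.
  refine ⟨l⁻¹.toNNReal, Real.toNNReal_lt_one.2 (inv_lt_one_of_one_lt₀ hl),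
    {x | ∀ k, ∀ a ∈ α, T^[k] x ∈ a → T^[k] x ∈ Ω a}, hT.ae_iterate (hT.ae_mem_of_mem hΩ0), ?_⟩
  rintro w hw n x ⟨hxY, hx⟩ y ⟨hyY, hy⟩ k hk
  induction hk using Nat.decreasingInduction with
  | of_succ k hk ih =>
    have h1 := hΩ _ (hw k) _ (hxY k _ (hw k) (hx k hk)) _ (hyY k _ (hw k) (hy k hk))
    rw [← Function.iterate_succ_apply' T, ← Function.iterate_succ_apply' T] at h1
    have h2 : edist (T^[k] x) (T^[k] y) ≤
        (l⁻¹.toNNReal : ℝ≥0∞) * edist (T^[k + 1] x) (T^[k + 1] y) := by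
      rw [edist_nndist, edist_nndist, ← ENNReal.coe_mul, ENNReal.coe_le_coe, ← NNReal.coe_le_coe]
      push_cast
      rw [Real.coe_toNNReal _ hl', inv_mul_eq_div, le_div_iff₀ (by positivity), mul_comm]
      exact h1
    refine h2.trans ((mul_le_mul_right ih _).trans_eq ?_)
    rw [← mul_assoc, ← pow_succ', Nat.sub_add_eq, Nat.sub_add_cancel (by omega)]
  | self => simp

/-- Injectivity and null measurability of images exclude the default value `0` of `Measure.comap`.
-/
theorem branchMeasure_apply (hT : IsGibbsMarkov m T α) {a : Set X} (ha : a ∈ α) {Z : Set X}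
    (hZ : MeasurableSet Z) : branchMeasure m T a Z = m (T '' (Z ∩ a)) := by
  rw [branchMeasure, Measure.map_apply measurable_subtype_coe hZ]
  have himg : ∀ s : Set a, (fun x : a => T x) '' s = T '' (Subtype.val '' s) := fun s =>
    image_comp T Subtype.val s
  rw [Measure.comap_apply₀ (fun x : a => T x) _ (injOn_iff_injective.1 (hT.injOn a ha)) ?_
    (measurable_subtype_coe hZ).nullMeasurableSet, himg, Subtype.image_preimage_coe, inter_comm]
  intro s hs
  rw [himg]
  exact hT.nullMeasurableSet_image a ha _ (by simp)
    ((MeasurableEmbedding.subtype_coe (hT.measurableSet a ha)).measurableSet_image.2 hs)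

theorem isFiniteMeasure_branchMeasure [IsFiniteMeasure m] (hT : IsGibbsMarkov m T α) {a : Set X}
    (ha : a ∈ α) : IsFiniteMeasure (branchMeasure m T a) :=
  ⟨by rw [hT.branchMeasure_apply ha .univ]; exact measure_lt_top _ _⟩

theorem branchMeasure_absolutelyContinuous (hT : IsGibbsMarkov m T α) {a : Set X} (ha : a ∈ α) :
    branchMeasure m T a ≪ m.restrict a := by
  refine Measure.AbsolutelyContinuous.mk fun Z hZ h => ?_
  rw [Measure.restrict_apply hZ] at h
  rw [hT.branchMeasure_apply ha hZ]
  exact hT.null_image a ha _ inter_subset_right h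

theorem restrict_absolutelyContinuous (hT : IsGibbsMarkov m T α) {a : Set X} (ha : a ∈ α) :
    m.restrict a ≪ branchMeasure m T a := by
  refine Measure.AbsolutelyContinuous.mk fun Z hZ h => ?_
  rw [hT.branchMeasure_apply ha hZ] at h
  rw [Measure.restrict_apply hZ]
  exact measure_mono_null (subset_preimage_image T _) (hT.quasiMeasurePreserving.preimage_null h)

/-- The jacobian of `T` on `a`. -/
noncomputable def jac (m : Measure X) (T : X → X) (a : Set X) : X → ℝ≥0∞ :=
  (branchMeasure m T a).rnDeriv (m.restrict a)

omit [MetricSpace X] in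
theorem measurable_jac (a : Set X) : Measurable (jac m T a) := Measure.measurable_rnDeriv _ _

theorem withDensity_jac [IsFiniteMeasure m] (hT : IsGibbsMarkov m T α) {a : Set X} (ha : a ∈ α) :
    (m.restrict a).withDensity (jac m T a) = branchMeasure m T a := by
  have := hT.isFiniteMeasure_branchMeasure ha
  exact Measure.withDensity_rnDeriv_eq _ _ (hT.branchMeasure_absolutelyContinuous ha)

/-- The two measures on `a` are equivalent, so their densities are almost everywhere reciprocal,
finite and nonzero, and the distortion of `invJacobian` passes to `jac`. -/
theorem exists_jac_le [IsFiniteMeasure m] (hT : IsGibbsMarkov m T α) :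
    ∃ C : ℝ≥0, ∃ Ω : Set X → Set X, ∀ a ∈ α, m (a \ Ω a) = 0 ∧ ∀ x ∈ Ω a, ∀ y ∈ Ω a,
      jac m T a x ≤ (1 + C * edist (T x) (T y)) * jac m T a y := by
  obtain ⟨C, h⟩ := hT.distortion
  choose! Ω hΩa hΩ0 hΩ using h
  refine ⟨C.toNNReal, fun a => Ω a ∩ {x | jac m T a x =
    ((m.restrict a).rnDeriv (branchMeasure m T a) x)⁻¹ ∧
    (m.restrict a).rnDeriv (branchMeasure m T a) x ≠ 0 ∧
    (m.restrict a).rnDeriv (branchMeasure m T a) x ≠ ∞}, fun a ha => ⟨?_, ?_⟩⟩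
  · have := hT.isFiniteMeasure_branchMeasure ha
    have hac := hT.restrict_absolutelyContinuous ha
    have hae : ∀ᵐ x ∂m.restrict a, jac m T a x =
        ((m.restrict a).rnDeriv (branchMeasure m T a) x)⁻¹ ∧
        (m.restrict a).rnDeriv (branchMeasure m T a) x ≠ 0 ∧
        (m.restrict a).rnDeriv (branchMeasure m T a) x ≠ ∞ := by
      filter_upwards [Measure.inv_rnDeriv hac, Measure.rnDeriv_pos hac,
        hac (Measure.rnDeriv_ne_top (m.restrict a) (branchMeasure m T a))] with x h1 h2 h3
      exact ⟨h1.symm, h2.ne', h3⟩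
    rw [ae_restrict_iff' (hT.measurableSet a ha), ae_iff] at hae
    refine measure_mono_null ?_ (measure_union_null (hΩ0 a ha) hae)
    rintro x ⟨hx, hx'⟩
    by_cases hxΩ : x ∈ Ω a
    · exact Or.inr fun h => hx' ⟨hxΩ, h hx⟩
    · exact Or.inl ⟨hx, hxΩ⟩
  · rintro x ⟨hx, hx1, hx2, hx3⟩ y ⟨hy, hy1, hy2, hy3⟩
    -- The points are exchanged because taking inverses reverses the inequality.
    have h1 := hΩ a ha y hy x hx
    rw [hx1, hy1]
    simp only [invJacobian] at h1
    set p := (m.restrict a).rnDeriv (branchMeasure m T a) x with hp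
    set q := (m.restrict a).rnDeriv (branchMeasure m T a) y with hq
    have hp' : 0 < p.toReal := ENNReal.toReal_pos hx2 hx3
    have h2 : q.toReal ≤ (1 + C.toNNReal * dist (T x) (T y)) * p.toReal := by
      rw [← div_le_iff₀ hp']
      have h3 := (abs_le.1 h1).1
      have h4 : C * dist (T y) (T x) ≤ C.toNNReal * dist (T x) (T y) := by
        rw [dist_comm]
        exact mul_le_mul_of_nonneg_right (Real.le_coe_toNNReal C) dist_nonneg
      linarith
    have h3 : q ≤ (1 + C.toNNReal * edist (T x) (T y)) * p := by
      rw [← ENNReal.toReal_le_toReal hy3 (by finiteness)]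
      rw [ENNReal.toReal_mul, ENNReal.toReal_add (by simp) (by finiteness), ENNReal.toReal_mul]
      simpa [← dist_edist] using h2
    rw [← div_eq_mul_inv, ENNReal.le_div_iff_mul_le (Or.inl hy2) (Or.inl hy3), mul_comm,
      ← div_eq_mul_inv]
    exact ENNReal.div_le_of_le_mul h3

theorem setLIntegral_image [IsFiniteMeasure m] (hT : IsGibbsMarkov m T α) {a : Set X} (ha : a ∈ α)
    {B : Set X} (hB : MeasurableSet B) (hBa : B ⊆ a) {φ : X → ℝ≥0∞} (hφ : Measurable φ) :
    ∫⁻ x in T '' B, φ x ∂m = ∫⁻ x in B, jac m T a x * φ (T x) ∂m := by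
  have hmap : ((branchMeasure m T a).restrict B).map T = m.restrict (T '' B) := by
    ext Z hZ
    rw [Measure.map_apply hT.measurable_map hZ,
      Measure.restrict_apply (hT.measurable_map hZ), Measure.restrict_apply hZ,
      hT.branchMeasure_apply ha ((hT.measurable_map hZ).inter hB),
      inter_eq_left.2 (inter_subset_right.trans hBa), ← image_preimage_inter, inter_comm]
  rw [← hmap, lintegral_map hφ hT.measurable_map, ← hT.withDensity_jac ha, restrict_withDensity hB,
    lintegral_withDensity_eq_lintegral_mul (g := fun x => φ (T x)) _ (measurable_jac a)
      (hφ.comp hT.measurable_map), Measure.restrict_restrict hB, inter_eq_left.2 hBa]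
  rfl

/-- The jacobian of the iterate `T^n` on a cylinder of length `n`. -/
noncomputable def iterJac (m : Measure X) (T : X → X) (w : ℕ → Set X) (n : ℕ) (x : X) : ℝ≥0∞ :=
  ∏ k ∈ Finset.range n, jac m T (w k) (T^[k] x)

omit [MetricSpace X] in
theorem measurable_iterJac (hT : Measurable T) (w : ℕ → Set X) (n : ℕ) :
    Measurable (iterJac m T w n) :=
  Finset.measurable_prod _ fun k _ => (measurable_jac _).comp (hT.iterate k)

theorem measure_image_iterate [IsFiniteMeasure m] (hT : IsGibbsMarkov m T α) (n : ℕ)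
    {w : ℕ → Set X} (hw : ∀ k, w k ∈ α) {B : Set X} (hB : MeasurableSet B)
    (hBw : B ⊆ wordCylinder T w n) : m (T^[n] '' B) = ∫⁻ x in B, iterJac m T w n x ∂m := by
  induction n generalizing w B with
  | zero => simp [iterJac]
  | succ n ih =>
    have hB0 : B ⊆ w 0 := fun x hx => (mem_wordCylinder_succ.1 (hBw hx)).1
    have hTB : T '' B ⊆ wordCylinder T (fun k => w (k + 1)) n := by
      rintro _ ⟨x, hx, rfl⟩
      exact (mem_wordCylinder_succ.1 (hBw hx)).2
    -- `T '' B` is only null measurable; a measurable subset of full measure replaces it, and the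
    -- discarded part remains null under `T^[n]`.
    obtain ⟨B', hB'sub, hB', hB'ae⟩ :=
      (hT.nullMeasurableSet_image _ (hw 0) B hB0 hB).exists_measurable_subset_ae_eq
    have hnull : m (T^[n] '' (T '' B \ B')) = 0 :=
      hT.measure_image_iterate_eq_zero n (fun k => hw (k + 1)) (sdiff_subset.trans hTB)
        (ae_le_set.1 hB'ae.symm.le)
    have h1 : m (T^[n + 1] '' B) = m (T^[n] '' B') := by
      rw [Function.iterate_succ, image_comp]
      refine le_antisymm ?_ (measure_mono (image_mono hB'sub))
      calc m (T^[n] '' (T '' B)) ≤ m (T^[n] '' B' ∪ T^[n] '' (T '' B \ B')) := by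
            rw [← image_union, union_sdiff_cancel hB'sub]
        _ ≤ m (T^[n] '' B') + m (T^[n] '' (T '' B \ B')) := measure_union_le _ _
        _ = m (T^[n] '' B') := by rw [hnull, add_zero]
    rw [h1, ih (fun k => hw (k + 1)) hB' (hB'sub.trans hTB), setLIntegral_congr hB'ae,
      hT.setLIntegral_image (hw 0) hB hB0 (measurable_iterJac hT.measurable_map _ _)]
    refine lintegral_congr fun x => ?_
    simp only [iterJac]
    rw [Finset.prod_range_succ', mul_comm]
    rfl

theorem prod_one_add_mul_pow_le (ρ : ℝ≥0) (hρ : ρ < 1) (M : ℝ≥0) (n : ℕ) :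
    ∏ k ∈ Finset.range n, (1 + (M : ℝ≥0∞) * (ρ : ℝ≥0∞) ^ k) ≤
      ENNReal.ofReal (Real.exp (M * (1 - ρ)⁻¹)) := by
  have h1 : ∏ k ∈ Finset.range n, (1 + (M : ℝ≥0∞) * (ρ : ℝ≥0∞) ^ k) =
      ENNReal.ofReal (∏ k ∈ Finset.range n, (1 + (M : ℝ) * (ρ : ℝ) ^ k)) := by
    rw [ENNReal.ofReal_prod_of_nonneg fun k _ => by positivity]
    refine Finset.prod_congr rfl fun k _ => ?_
    rw [ENNReal.ofReal_add (by simp) (by positivity), ENNReal.ofReal_mul (by simp),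
      ENNReal.ofReal_pow (by simp)]
    simp
  rw [h1]
  refine ENNReal.ofReal_le_ofReal ?_
  calc ∏ k ∈ Finset.range n, (1 + (M : ℝ) * (ρ : ℝ) ^ k)
      ≤ ∏ k ∈ Finset.range n, Real.exp ((M : ℝ) * (ρ : ℝ) ^ k) :=
        Finset.prod_le_prod (fun k _ => by positivity) fun k _ => by
          rw [add_comm]; exact Real.add_one_le_exp _
    _ = Real.exp (M * ∑ k ∈ Finset.range n, (ρ : ℝ) ^ k) := by
        rw [← Real.exp_sum, Finset.mul_sum]
    _ ≤ _ := by
        have hρ' : (ρ : ℝ) < 1 := by exact_mod_cast hρ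
        have h2 : ((1 - ρ)⁻¹ : ℝ≥0) = (1 - (ρ : ℝ))⁻¹ := by
          rw [NNReal.coe_inv, NNReal.coe_sub hρ.le, NNReal.coe_one]
        rw [h2, ← tsum_geometric_of_lt_one (NNReal.coe_nonneg ρ) hρ']
        gcongr
        exact (summable_geometric_of_lt_one ρ.2 hρ').sum_le_tsum _ fun k _ => by positivity

/-- Bounded distortion: `T^n` does not expand the relative measure of subsets of cylinders by more
than a constant. -/
theorem exists_measure_image_mul_le [BoundedSpace X] [IsProbabilityMeasure m]
    (hT : IsGibbsMarkov m T α) :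
    ∃ K : ℝ≥0∞, K ≠ ∞ ∧ ∀ (n : ℕ) (w : ℕ → Set X), (∀ k, w k ∈ α) → ∀ B, MeasurableSet B →
      B ⊆ wordCylinder T w n → m (T^[n] '' B) * m (wordCylinder T w n) ≤ K * m B := by
  obtain ⟨ρ, hρ, Y, hY, hcontr⟩ := hT.exists_contraction
  obtain ⟨C, Ω, hΩ⟩ := hT.exists_jac_le
  set Δ : ℝ≥0 := (Metric.ediam (univ : Set X)).toNNReal with hΔ
  have hΔ' : ∀ x y : X, edist x y ≤ Δ := fun x y => by
    rw [hΔ, ENNReal.coe_toNNReal (Metric.isBounded_iff_ediam_ne_top.1 (Bornology.IsBounded.all _))]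
    exact Metric.edist_le_ediam_of_mem (mem_univ _) (mem_univ _)
  set K := ENNReal.ofReal (Real.exp ((C * Δ : ℝ≥0) * (1 - ρ)⁻¹)) with hK
  refine ⟨K, ENNReal.ofReal_ne_top, fun n w hw B hB hBw => ?_⟩
  set Y' : Set X := Y ∩ {x | ∀ k, ∀ a ∈ α, T^[k] x ∈ a → T^[k] x ∈ Ω a} with hY'
  have hY'ae : ∀ᵐ x ∂m, x ∈ Y' :=
    hY.and (hT.ae_iterate (hT.ae_mem_of_mem fun a ha => (hΩ a ha).1))
  have hcyl := measurableSet_wordCylinder hT.measurable_map (fun k => hT.measurableSet _ (hw k)) n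
  -- The distance at time `k + 1` is at most `ρ ^ (n - 1 - k) * Δ`, so the distortion factors have a
  -- product bounded independently of `n`.
  have hdist : ∀ x ∈ Y' ∩ wordCylinder T w n, ∀ y ∈ Y' ∩ wordCylinder T w n,
      iterJac m T w n x ≤ K * iterJac m T w n y := by
    rintro x ⟨hxY, hx⟩ y ⟨hyY, hy⟩
    have hstep : ∀ k ∈ Finset.range n, jac m T (w k) (T^[k] x) ≤
        (1 + ((C * Δ : ℝ≥0) : ℝ≥0∞) * (ρ : ℝ≥0∞) ^ (n - 1 - k)) * jac m T (w k) (T^[k] y) := by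
      intro k hk
      have hk : k < n := Finset.mem_range.1 hk
      refine ((hΩ _ (hw k)).2 _ (hxY.2 k _ (hw k) (hx k hk)) _
        (hyY.2 k _ (hw k) (hy k hk))).trans ?_
      refine mul_le_mul_left (add_le_add_right ?_ _) _
      rw [← Function.iterate_succ_apply' T, ← Function.iterate_succ_apply' T]
      have := (hcontr w hw n x ⟨hxY.1, hx⟩ y ⟨hyY.1, hy⟩ (k + 1) hk).trans
        (mul_le_mul_right (hΔ' _ _) _)
      calc _ ≤ (C : ℝ≥0∞) * ((ρ : ℝ≥0∞) ^ (n - (k + 1)) * Δ) := by gcongr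
        _ = _ := by rw [show n - (k + 1) = n - 1 - k by omega]; push_cast; ring
    calc iterJac m T w n x ≤ ∏ k ∈ Finset.range n, (1 + ((C * Δ : ℝ≥0) : ℝ≥0∞) *
          (ρ : ℝ≥0∞) ^ (n - 1 - k)) * jac m T (w k) (T^[k] y) := Finset.prod_le_prod' hstep
      _ = (∏ k ∈ Finset.range n, (1 + ((C * Δ : ℝ≥0) : ℝ≥0∞) *
          (ρ : ℝ≥0∞) ^ k)) * iterJac m T w n y := by
        rw [Finset.prod_mul_distrib, Finset.prod_range_reflect
          (fun k => 1 + ((C * Δ : ℝ≥0) : ℝ≥0∞) * (ρ : ℝ≥0∞) ^ k)]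
        rfl
      _ ≤ K * iterJac m T w n y := by
        gcongr
        exact prod_one_add_mul_pow_le ρ hρ _ n
  -- Averaging the comparison over `y` bounds the jacobian at `x`, since its integral over the
  -- cylinder is the measure of the image, at most `1`.
  have hpt : ∀ x ∈ Y' ∩ wordCylinder T w n,
      iterJac m T w n x * m (wordCylinder T w n) ≤ K := by
    intro x hx
    calc iterJac m T w n x * m (wordCylinder T w n)
        = ∫⁻ y in wordCylinder T w n, iterJac m T w n x ∂m := by rw [setLIntegral_const]
      _ ≤ ∫⁻ y in wordCylinder T w n, K * iterJac m T w n y ∂m := by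
        refine setLIntegral_mono_ae' hcyl ?_
        filter_upwards [hY'ae] with y hy hyc using hdist x hx y ⟨hy, hyc⟩
      _ = K * m (T^[n] '' wordCylinder T w n) := by
        rw [lintegral_const_mul _ (measurable_iterJac hT.measurable_map _ _),
          hT.measure_image_iterate n hw hcyl subset_rfl]
      _ ≤ K := mul_le_of_le_one_right' prob_le_one
  calc m (T^[n] '' B) * m (wordCylinder T w n)
      = ∫⁻ x in B, iterJac m T w n x * m (wordCylinder T w n) ∂m := by
        rw [hT.measure_image_iterate n hw hB hBw,
          lintegral_mul_const _ (measurable_iterJac hT.measurable_map _ _)]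
    _ ≤ ∫⁻ _ in B, K ∂m := by
        refine setLIntegral_mono_ae' hB ?_
        filter_upwards [hY'ae] with x hx hxB using hpt x ⟨hx, hBw hxB⟩
    _ = K * m B := by rw [setLIntegral_const]

end IsGibbsMarkov

/-! ### Selecting a piece, averaging along orbits, propagating closeness. -/

section Selection

variable {X : Type*} [MeasurableSpace X] {m : Measure X}

/-- If a set `F` is almost a union of pieces of a partition, one of the pieces is almost contained
in `F`. -/
theorem exists_measure_diff_le {ι : Type*} [Countable ι] {c : ι → Set X}
    (hc : ∀ i, MeasurableSet (c i)) (hd : Pairwise (Function.onFun (AEDisjoint m) c))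
    {A F F' Y : Set X} (hY : ∀ᵐ x ∂m, x ∈ Y) (hF : MeasurableSet F)
    (hA : ∀ᵐ x ∂m, x ∈ A → ∃ i, x ∈ c i)
    (hF' : ∀ i, ∀ x ∈ Y ∩ c i, ∀ y ∈ Y ∩ c i, x ∈ F → y ∈ F') {δ : ℝ≥0∞}
    (hδ : m (F' \ F) < δ * m (A ∩ F)) :
    ∃ i, m (c i) ≠ 0 ∧ m (c i \ F) ≤ δ * m (c i) := by
  by_contra! hcon
  have hle : ∀ i, δ * m (c i) ≤ m (c i \ F) := fun i => by
    rcases eq_or_ne (m (c i)) 0 with h | h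
    · simp [h]
    · exact (hcon i h).le
  -- The pieces indexed by `I` cover `A ∩ F` and lie in `F'`, both modulo `0`; if each had a
  -- proportion at least `δ` outside `F`, then `F' \ F` would be too large.
  set I : Set ι := {i | (Y ∩ c i ∩ F).Nonempty} with hI
  have h1 : m (A ∩ F) ≤ ∑' i : I, m (c i) := by
    refine le_trans (measure_mono_ae ?_) (measure_iUnion_le _)
    filter_upwards [hY, hA] with x hxY hxA hx
    obtain ⟨i, hi⟩ := hxA hx.1
    exact mem_iUnion.2 ⟨⟨i, x, ⟨hxY, hi⟩, hx.2⟩, hi⟩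
  have h2 : ∑' i : I, m (c i \ F) ≤ m (F' \ F) := by
    rw [← measure_iUnion₀ (f := fun i : I => c i \ F) (fun i j hij => ?_)
      fun i => ((hc i).diff hF).nullMeasurableSet]
    · refine measure_mono_ae ?_
      filter_upwards [hY] with y hyY hy
      obtain ⟨⟨i, x, hx, hxF⟩, hyi, hyF⟩ := mem_iUnion.1 hy
      exact ⟨hF' i x hx y ⟨hyY, hyi⟩ hxF, hyF⟩
    · exact (hd fun h => hij (Subtype.ext h)).mono sdiff_subset sdiff_subset
  refine hδ.not_ge ?_
  calc δ * m (A ∩ F) ≤ δ * ∑' i : I, m (c i) := by gcongr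
    _ = ∑' i : I, δ * m (c i) := ENNReal.tsum_mul_left.symm
    _ ≤ ∑' i : I, m (c i \ F) := ENNReal.tsum_le_tsum fun i => hle i
    _ ≤ m (F' \ F) := h2

/-- By invariance all the terms have the same integral up to their weights, which are dominated by a
geometric series. -/
theorem lintegral_sum_pow_mul_le {T : X → X} (hm : MeasurePreserving T m m) {φ : X → ℝ≥0∞}
    (hφ : Measurable φ) {ρ : ℝ≥0∞} (hρ : ρ ≤ 1) (n : ℕ) :
    ∫⁻ x, ∑ k ∈ Finset.range n, ρ ^ (n - k) * φ (T^[k] x) ∂m ≤ (1 - ρ)⁻¹ * ∫⁻ x, φ x ∂m := by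
  have hk : ∀ k, ∫⁻ x, φ (T^[k] x) ∂m = ∫⁻ x, φ x ∂m := fun k => (hm.iterate k).lintegral_comp hφ
  have hmeas : ∀ k, Measurable fun x => φ (T^[k] x) := fun k => hφ.comp (hm.measurable.iterate k)
  rw [lintegral_finsetSum _ fun k _ => (hmeas k).const_mul _]
  simp_rw [lintegral_const_mul _ (hmeas _), hk]
  rw [← Finset.sum_mul]
  gcongr
  rw [← ENNReal.tsum_geometric, ← Finset.sum_range_reflect]
  refine le_trans (Finset.sum_le_sum fun k hk => ?_) (ENNReal.sum_le_tsum (Finset.range n))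
  have := Finset.mem_range.1 hk
  exact pow_le_pow_right_of_le_one' hρ (by omega)

theorem tendsto_measure_cthickening_diff [PseudoEMetricSpace X] [OpensMeasurableSpace X]
    [IsFiniteMeasure m] {F : Set X} (hF : IsClosed F) :
    Filter.Tendsto (fun r => m (Metric.cthickening r F \ F)) (nhds 0) (nhds 0) := by
  have h := ENNReal.Tendsto.sub (tendsto_measure_cthickening_of_isClosed (μ := m)
    ⟨1, one_pos, measure_ne_top _ _⟩ hF) (tendsto_const_nhds (x := m F))
    (Or.inl (measure_ne_top _ _))
  rw [tsub_self] at h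
  refine h.congr fun r => ?_
  rw [measure_sdiff (Metric.self_subset_cthickening F) hF.measurableSet.nullMeasurableSet
    (measure_ne_top _ _)]

end Selection

/-- A cocycle relation propagates closeness along the orbits. -/
theorem edist_iterate_le {X G : Type*} [SeminormedAddCommGroup G] {T : X → X} {f u : X → G}
    {x y : X} (hx : ∀ k, f (T^[k] x) = u (T^[k] x) - u (T (T^[k] x)))
    (hy : ∀ k, f (T^[k] y) = u (T^[k] y) - u (T (T^[k] y))) (n : ℕ) :
    edist (u (T^[n] x)) (u (T^[n] y)) ≤
      edist (u x) (u y) + ∑ k ∈ Finset.range n, edist (f (T^[k] x)) (f (T^[k] y)) := by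
  induction n with
  | zero => simp
  | succ n ih =>
    have h : ∀ z, f (T^[n] z) = u (T^[n] z) - u (T (T^[n] z)) →
        u (T^[n + 1] z) = u (T^[n] z) - f (T^[n] z) := fun z hz => by
      rw [hz, Function.iterate_succ_apply']; abel
    rw [h x (hx n), h y (hy n), Finset.sum_range_succ, ← add_assoc]
    refine le_trans ?_ (add_le_add_left ih _)
    rw [sub_eq_add_neg, sub_eq_add_neg]
    exact (edist_add_add_le _ _ _ _).trans_eq (by rw [edist_neg_neg])

/-! ### Cylinders with controlled weights on which `u` is nearly constant. -/

namespace IsGibbsMarkov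

variable {X : Type*} [MetricSpace X] [MeasurableSpace X] {m : Measure X} {T : X → X}
  {α : Set (Set X)}

/-- The set of words with letters in `α` that are constant equal to `b` from index `n` on. -/
def words (α : Set (Set X)) (b : Set X) (n : ℕ) : Set (ℕ → Set X) :=
  {w | (∀ k, w k ∈ α) ∧ ∀ k, n ≤ k → w k = b}

omit [MetricSpace X] [MeasurableSpace X] in
theorem countable_words (hα : α.Countable) (b : Set X) (n : ℕ) : (words α b n).Countable := by
  have := hα.to_subtype
  have hinj : Function.Injective
      fun (w : words α b n) (k : Fin n) => (⟨w.1 k, w.2.1 k⟩ : α) := by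
    intro w w' h
    refine Subtype.ext (funext fun k => ?_)
    rcases lt_or_ge k n with hk | hk
    · exact congrArg Subtype.val (congrFun h ⟨k, hk⟩)
    · rw [w.2.2 k hk, w'.2.2 k hk]
  exact countable_coe_iff.1 hinj.countable

theorem aedisjoint_wordCylinder (hT : IsGibbsMarkov m T α) (b : Set X) (n : ℕ) :
    Pairwise (Function.onFun (AEDisjoint m)
      fun w : words α b n => wordCylinder T (w : ℕ → Set X) (n + 1)) := by
  intro w w' hww
  obtain ⟨k, hk⟩ : ∃ k, w.1 k ≠ w'.1 k := by
    by_contra! h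
    exact hww (Subtype.ext (funext h))
  have hkn : k < n + 1 := by
    by_contra! h
    exact hk (by rw [w.2.2 k (by omega), w'.2.2 k (by omega)])
  refine measure_mono_null ?_ ((hT.quasiMeasurePreserving.iterate k).preimage_null
    (hT.aedisjoint (w.2.1 k) (w'.2.1 k) hk))
  rintro x ⟨hx, hx'⟩
  exact ⟨hx k hkn, hx' k hkn⟩

/-- A definite proportion of the points which are in `b` at time `n` have an itinerary along which
the weights, discounted by the contraction, have a controlled sum. -/
theorem exists_words_cover [IsProbabilityMeasure m] (hT : IsGibbsMarkov m T α)
    (hm : MeasurePreserving T m m) {b : Set X} (hb : b ∈ α) (D : Set X → ℝ≥0∞) {ρ : ℝ≥0∞} (hρ : ρ ≤ 1)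
    {K : ℝ≥0∞} (hK0 : K ≠ 0) (hK' : K ≠ ∞)
    (hK : (1 - ρ)⁻¹ * ∑' a : α, m a * D a ≤ K * (m b / 2)) (n : ℕ) :
    ∃ A : Set X, m b / 2 ≤ m A ∧ ∀ᵐ x ∂m, x ∈ A → ∃ w ∈ words α b n,
      x ∈ wordCylinder T w (n + 1) ∧
        ∑ k ∈ Finset.range (n + 1), ρ ^ (n + 1 - k) * D (w k) ≤ K := by
  have hcount := hT.countable.to_subtype
  set φ : X → ℝ≥0∞ := fun x => ∑' a : α, (a : Set X).indicator (fun _ => D a) x with hφ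
  have hφm : Measurable φ := Measurable.tsum fun a =>
    measurable_const.indicator (hT.measurableSet a a.2)
  have hφi : ∫⁻ x, φ x ∂m = ∑' a : α, m a * D a := by
    rw [hφ, lintegral_tsum fun a : α =>
      (measurable_const.indicator (hT.measurableSet a a.2)).aemeasurable]
    refine tsum_congr fun a => ?_
    rw [lintegral_indicator_const (hT.measurableSet a a.2), mul_comm]
  have hφle : ∀ a ∈ α, ∀ x ∈ a, D a ≤ φ x := by
    intro a ha x hx
    refine le_trans ?_ (ENNReal.le_tsum (⟨a, ha⟩ : α))
    rw [indicator_of_mem hx]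
  set h : X → ℝ≥0∞ := fun x => ∑ k ∈ Finset.range (n + 1), ρ ^ (n + 1 - k) * φ (T^[k] x) with hh
  have hhm : Measurable h := Finset.measurable_sum _ fun k _ =>
    (hφm.comp (hm.measurable.iterate k)).const_mul _
  refine ⟨T^[n] ⁻¹' b \ {x | K ≤ h x}, ?_, ?_⟩
  -- Markov's inequality; since `T^[n] ⁻¹' b` has measure `m b`, at least half of it survives.
  · have h1 : m {x | K ≤ h x} ≤ m b / 2 := by
      refine (meas_ge_le_lintegral_div hhm.aemeasurable hK0 hK').trans ?_
      refine ENNReal.div_le_of_le_mul' ?_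
      exact ((lintegral_sum_pow_mul_le hm hφm hρ (n + 1)).trans_eq (by rw [hφi])).trans hK
    have h2 : m b ≤ m (T^[n] ⁻¹' b \ {x | K ≤ h x}) + m b / 2 := by
      rw [← (hm.iterate n).measure_preimage (hT.measurableSet b hb).nullMeasurableSet]
      refine (measure_le_inter_add_sdiff m _ {x | K ≤ h x}).trans ?_
      rw [add_comm, (hm.iterate n).measure_preimage (hT.measurableSet b hb).nullMeasurableSet]
      gcongr
      exact (measure_mono inter_subset_right).trans h1
    rw [← ENNReal.sub_half (measure_ne_top m b)]
    exact tsub_le_iff_right.2 h2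
  · filter_upwards [hT.ae_iterate hT.ae_exists_mem] with x hx hxA
    choose w hwα hw using hx
    -- The itinerary is kept before time `n`; the letter `b` at time `n` is legitimate because `x ∈
    -- T^[n] ⁻¹' b`, and the later ones are padding.
    refine ⟨fun k => if k < n then w k else b, ⟨fun k => ?_, fun k hk => if_neg (by omega)⟩,
      fun k hk => ?_, ?_⟩
    · by_cases hk : k < n <;> simp [hk, hwα, hb]
    · by_cases hkn : k < n
      · simpa [hkn] using hw k
      · obtain rfl : k = n := by omega
        simpa using hxA.1
    · refine le_trans (Finset.sum_le_sum fun k hk => ?_) (not_le.1 hxA.2).le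
      have hk := Finset.mem_range.1 hk
      refine mul_le_mul_right ?_ _
      by_cases hkn : k < n
      · simpa [hkn] using hφle _ (hwα k) _ (hw k)
      · obtain rfl : k = n := by omega
        simpa using hφle _ hb _ hxA.1

/-- There are cylinders along which the weights have a controlled sum, and most of which is mapped
by `u` into a small ball. -/
theorem exists_wordCylinder [BoundedSpace X] [BorelSpace X] [IsProbabilityMeasure m]
    (hT : IsGibbsMarkov m T α) (hm : MeasurePreserving T m m) {b : Set X} (hb : b ∈ α)
    (D : Set X → ℝ≥0∞) {ρ : ℝ≥0} (hρ : ρ < 1) {Y : Set X} (hY : ∀ᵐ x ∂m, x ∈ Y)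
    (hcontr : ∀ (w : ℕ → Set X), (∀ k, w k ∈ α) →
      ∀ n, ∀ x ∈ Y ∩ wordCylinder T w n, ∀ y ∈ Y ∩ wordCylinder T w n, ∀ k ≤ n,
        edist (T^[k] x) (T^[k] y) ≤ (ρ : ℝ≥0∞) ^ (n - k) * edist (T^[n] x) (T^[n] y))
    {K : ℝ≥0∞} (hK0 : K ≠ 0) (hK' : K ≠ ∞)
    (hK : (1 - (ρ : ℝ≥0∞))⁻¹ * ∑' a : α, m a * D a ≤ K * (m b / 2))
    {G : Type*} [PseudoEMetricSpace G] [MeasurableSpace G] [BorelSpace G] {u : X → G}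
    (hu : Measurable u) {t : Set G} (ht : t.Countable) (hut : ∀ᵐ x ∂m, u x ∈ closure t)
    {ε δ : ℝ≥0∞} (hε : ε ≠ 0) (hδ : δ ≠ 0) :
    ∃ n, ∃ w ∈ words α b n, ∑ k ∈ Finset.range (n + 1), (ρ : ℝ≥0∞) ^ (n + 1 - k) * D (w k) ≤ K ∧
      m (wordCylinder T w (n + 1)) ≠ 0 ∧ ∃ g : G,
        m (wordCylinder T w (n + 1) \ {x | edist (u x) g < ε}) ≤
          δ * m (wordCylinder T w (n + 1)) := by
  have hb0 : m b ≠ 0 := (hT.measure_pos b hb).ne'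
  have hmb : m b / 2 / 2 ≠ 0 := by simp [hb0]
  have htne : t.Nonempty := by
    obtain ⟨x, hx⟩ := hut.exists
    exact closure_nonempty_iff.1 ⟨_, hx⟩
  obtain ⟨g, rfl⟩ := ht.exists_eq_range htne
  have hball : ∀ i, MeasurableSet {x | edist (u x) (g i) < ε} := fun i =>
    hu Metric.isOpen_eball.measurableSet
  obtain ⟨e, he, hesum⟩ := ENNReal.exists_pos_sum_of_countable hmb ℕ
  -- Closed sets are needed so that the measure added by thickening tends to `0`.
  have hex : ∀ i, ∃ F ⊆ {x | edist (u x) (g i) < ε}, IsClosed F ∧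
      m ({x | edist (u x) (g i) < ε} \ F) < e i := fun i =>
    (hball i).exists_isClosed_sdiff_lt (measure_ne_top _ _) (by simpa using (he i).ne')
  choose F hFsub hFcl hFm using hex
  have hFinter : m (⋂ i, (F i)ᶜ) < m b / 2 / 2 := by
    refine lt_of_le_of_lt ?_ hesum
    calc m (⋂ i, (F i)ᶜ) ≤ m (⋃ i, {x | edist (u x) (g i) < ε} \ F i) := by
          refine measure_mono_ae ?_
          filter_upwards [hut] with x hx hxF
          obtain ⟨_, ⟨i, rfl⟩, hi⟩ := EMetric.mem_closure_iff.1 hx ε (pos_iff_ne_zero.2 hε)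
          exact mem_iUnion.2 ⟨i, hi, mem_iInter.1 hxF i⟩
      _ ≤ ∑' i, m ({x | edist (u x) (g i) < ε} \ F i) := measure_iUnion_le _
      _ ≤ ∑' i, (e i : ℝ≥0∞) := ENNReal.tsum_le_tsum fun i => (hFm i).le
  obtain ⟨N, hN⟩ := ((tendsto_measure_iInter_le (μ := m) (f := fun i => (F i)ᶜ)
    (fun i => (hFcl i).measurableSet.compl.nullMeasurableSet)
    ⟨0, measure_ne_top _ _⟩).eventually_lt_const hFinter).exists
  by_contra! hcon
  set Δ : ℝ≥0 := (Metric.ediam (univ : Set X)).toNNReal with hΔ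
  have hΔ' : ∀ x y : X, edist x y ≤ Δ := fun x y => by
    rw [hΔ, ENNReal.coe_toNNReal (Metric.isBounded_iff_ediam_ne_top.1 (Bornology.IsBounded.all _))]
    exact Metric.edist_le_ediam_of_mem (mem_univ _) (mem_univ _)
  have hr : Filter.Tendsto (fun n : ℕ => ((ρ ^ (n + 1) * Δ : ℝ≥0) : ℝ)) Filter.atTop (nhds 0) := by
    have h1 := ((tendsto_pow_atTop_nhds_zero_of_lt_one (NNReal.coe_nonneg ρ)
      (show (ρ : ℝ) < 1 by exact_mod_cast hρ)).comp (Filter.tendsto_add_atTop_nat 1)).mul_const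
      (Δ : ℝ)
    simpa using h1
  have hlim : Filter.Tendsto (fun n : ℕ => ∑ i ∈ Finset.range (N + 1),
      m (Metric.cthickening ((ρ ^ (n + 1) * Δ : ℝ≥0) : ℝ) (F i) \ F i)) Filter.atTop (nhds 0) := by
    have := tendsto_finsetSum (Finset.range (N + 1)) fun i _ =>
      (tendsto_measure_cthickening_diff (m := m) (hFcl i)).comp hr
    simpa using this
  -- At each `n`, the first `N + 1` sets `F i` capture at least `m b / 4` of the good points `A`. If
  -- no cylinder is suitable, `δ * m (A ∩ F i)` is at most the measure added to `F i` by thickening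
  -- it by the diameter bound for cylinders; sum over `i` and let `n → ∞`.
  have hcontra : δ * (m b / 2 / 2) ≤ 0 := by
    refine ge_of_tendsto' hlim fun n => ?_
    obtain ⟨A, hA, hAw⟩ := hT.exists_words_cover hm hb D (by exact_mod_cast hρ.le) hK0 hK' hK n
    have hAF : m b / 2 / 2 ≤ ∑ i ∈ Finset.range (N + 1), m (A ∩ F i) := by
      have h1 : m b / 2 ≤ (∑ i ∈ Finset.range (N + 1), m (A ∩ F i)) + m b / 2 / 2 := by
        refine hA.trans (le_trans ?_ (add_le_add_right hN.le _))
        refine le_trans (measure_mono ?_) ((measure_union_le _ _).trans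
          (add_le_add_left (measure_biUnion_finset_le (Finset.range (N + 1)) fun i => A ∩ F i) _))
        intro x hx
        by_cases hxF : ∃ i ≤ N, x ∈ F i
        · obtain ⟨i, hi, hxi⟩ := hxF
          exact Or.inl (mem_biUnion (by simpa using Nat.lt_succ_of_le hi) ⟨hx, hxi⟩)
        · push Not at hxF
          exact Or.inr (mem_iInter₂.2 hxF)
      have h2 : m b / 2 ≠ ∞ := by finiteness
      rw [← ENNReal.sub_half h2]
      exact tsub_le_iff_right.2 h1
    refine (mul_le_mul_right hAF δ).trans ?_
    rw [Finset.mul_sum]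
    refine Finset.sum_le_sum fun i _ => ?_
    by_contra! hlt
    have hcount : Countable {w : words α b n // ∑ k ∈ Finset.range (n + 1),
        (ρ : ℝ≥0∞) ^ (n + 1 - k) * D (w.1 k) ≤ K} := by
      have := (countable_words hT.countable b n).to_subtype
      infer_instance
    obtain ⟨⟨⟨w, hw⟩, hwK⟩, hw0, hwF⟩ := exists_measure_diff_le
      (ι := {w : words α b n // ∑ k ∈ Finset.range (n + 1),
        (ρ : ℝ≥0∞) ^ (n + 1 - k) * D (w.1 k) ≤ K})
      (c := fun w => wordCylinder T w.1.1 (n + 1))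
      (fun w => measurableSet_wordCylinder hm.measurable
        (fun k => hT.measurableSet _ (w.1.2.1 k)) _)
      (fun w w' h => hT.aedisjoint_wordCylinder b n fun h' => h (Subtype.ext h'))
      hY (hFcl i).measurableSet (by
        filter_upwards [hAw] with x hx hxA
        obtain ⟨w, hw, hxw, hwK⟩ := hx hxA
        exact ⟨⟨⟨w, hw⟩, hwK⟩, hxw⟩)
      (by
        intro w x hx y hy hxF
        refine Metric.mem_cthickening_of_edist_le y x _ _ hxF ?_
        rw [edist_comm]
        refine (hcontr _ w.1.2.1 _ x hx y hy 0 (Nat.zero_le _)).trans ?_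
        rw [ENNReal.ofReal_coe_nnreal]
        push_cast
        gcongr
        exact hΔ' _ _) hlt
    refine (hcon n w hw hwK hw0 (g i)).not_ge (le_trans (measure_mono ?_) hwF)
    exact sdiff_subset_sdiff_right (hFsub i)
  rw [nonpos_iff_eq_zero, mul_eq_zero] at hcontra
  exact hcontra.elim hδ hmb

end IsGibbsMarkov

universe v

/-! ### Regularity on images, and reduction to separable range. -/

namespace IsGibbsMarkov

variable {X : Type*} [MetricSpace X] [MeasurableSpace X] {m : Measure X} {T : X → X}
  {α : Set (Set X)}

theorem essLip_ne_top (hT : IsGibbsMarkov m T α) {G : Type*} [MetricSpace G] {f : X → G}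
    (hf : ∑' a : α, m a * essLip m f a < ∞) {a : Set X} (ha : a ∈ α) : essLip m f a ≠ ∞ := by
  intro h
  have h1 := ENNReal.ne_top_of_tsum_ne_top hf.ne ⟨a, ha⟩
  rw [h, ENNReal.mul_top (hT.measure_pos a ha).ne'] at h1
  exact h1 rfl

/-- Livsic regularity on the images of the elements of the partition, for almost everywhere
separably valued functions. -/
theorem exists_essLip_image_le [BoundedSpace X] [BorelSpace X] [IsProbabilityMeasure m]
    (hT : IsGibbsMarkov m T α) (hm : MeasurePreserving T m m) :
    ∃ R : ℝ≥0∞, R ≠ ∞ ∧ ∀ (G : Type v) [NormedAddCommGroup G] [MeasurableSpace G] [BorelSpace G]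
      (f u : X → G), ∑' a : α, m a * essLip m f a < ∞ → Measurable u →
      (∃ t : Set G, t.Countable ∧ ∀ᵐ x ∂m, u x ∈ closure t) →
      (∀ᵐ x ∂m, f x = u x - u (T x)) → ∀ b ∈ α,
      essLip m u (T '' b) ≤ R / (m b / 2) * ∑' a : α, m a * essLip m f a := by
  obtain ⟨ρ, hρ, Y, hY, hcontr⟩ := hT.exists_contraction
  obtain ⟨J, hJ, himg⟩ := hT.exists_measure_image_mul_le
  have hρ' : (ρ : ℝ≥0∞) < 1 := by exact_mod_cast hρ
  refine ⟨(1 - (ρ : ℝ≥0∞))⁻¹, ENNReal.inv_ne_top.2 (tsub_pos_iff_lt.2 hρ').ne', ?_⟩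
  rintro G _ _ _ f u hf hu ⟨t, ht, hut⟩ hfu b hb
  have hex : ∀ a ∈ α, ∃ Ω ⊆ a, m (a \ Ω) = 0 ∧
      ∀ x ∈ Ω, ∀ y ∈ Ω, edist (f x) (f y) ≤ essLip m f a * edist x y := fun a ha =>
    exists_edist_le_essLip (hT.essLip_ne_top hf ha)
  choose! Ω hΩa hΩ0 hΩ using hex
  set Y' : Set X := {x | x ∈ Y ∧ (∀ k, ∀ a ∈ α, T^[k] x ∈ a → T^[k] x ∈ Ω a) ∧
    ∀ k, f (T^[k] x) = u (T^[k] x) - u (T (T^[k] x))} with hY'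
  have hY'ae : ∀ᵐ x ∂m, x ∈ Y' :=
    hY.and ((hT.ae_iterate (hT.ae_mem_of_mem hΩ0)).and (hT.ae_iterate hfu))
  have hb0 : m b / 2 ≠ 0 := by simp [(hT.measure_pos b hb).ne']
  have hbt : m b / 2 ≠ ∞ := by finiteness
  -- Working with `K` strictly above the bound makes it nonzero, as Markov's inequality requires.
  refine le_of_forall_gt_imp_ge_of_dense fun K hK => ?_
  rcases eq_or_ne K ∞ with rfl | hKt
  · exact le_top
  have hK0 : K ≠ 0 := (pos_of_gt hK).ne'
  have hKle : (1 - (ρ : ℝ≥0∞))⁻¹ * ∑' a : α, m a * essLip m f a ≤ K * (m b / 2) := by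
    rw [← ENNReal.div_le_iff hb0 hbt, ENNReal.mul_div_right_comm]
    exact hK.le
  have step : ∀ ε δ : ℝ≥0∞, ε ≠ 0 → δ ≠ 0 → ∃ V ⊆ T '' b, m (T '' b \ V) ≤ J * δ ∧
      ∀ x ∈ V, ∀ y ∈ V, edist (u x) (u y) ≤ 2 * ε + K * edist x y := by
    intro ε δ hε hδ
    obtain ⟨n, w, hw, hwK, hw0, g, hg⟩ := hT.exists_wordCylinder hm hb (fun a => essLip m f a)
      hρ hY hcontr hK0 hKt hKle hu ht hut hε hδ
    set c := wordCylinder T w (n + 1) with hc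
    have hcm : MeasurableSet c :=
      measurableSet_wordCylinder hm.measurable (fun k => hT.measurableSet _ (hw.1 k)) _
    have hball : MeasurableSet {x | edist (u x) g < ε} := hu Metric.isOpen_eball.measurableSet
    have hwn : w n = b := hw.2 n le_rfl
    -- The missing part of `T '' b` comes from the defect of `T^[n + 1] '' c` and from `c \ Y'`,
    -- both negligible, and from the points where `u` is far from `g`, controlled by distortion.
    refine ⟨T^[n + 1] '' (c ∩ {x | edist (u x) g < ε} ∩ Y'), ?_, ?_, ?_⟩
    · rintro _ ⟨x, ⟨⟨hx, -⟩, -⟩, rfl⟩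
      exact ⟨T^[n] x, hwn ▸ hx n n.lt_succ_self, (Function.iterate_succ_apply' T n x).symm⟩
    · have h1 : m (T^[n + 1] '' (c \ {x | edist (u x) g < ε})) ≤ J * δ := by
        have h2 := himg (n + 1) w hw.1 _ (hcm.diff hball) sdiff_subset
        rw [← ENNReal.mul_le_mul_iff_left hw0 (measure_ne_top _ _), mul_assoc]
        exact h2.trans (mul_le_mul_right hg _)
      have h2 : m (T^[n + 1] '' (c \ Y')) = 0 :=
        hT.measure_image_iterate_eq_zero (n + 1) hw.1 sdiff_subset
          (measure_mono_null (fun x hx => hx.2) hY'ae)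
      have h3 := hT.measure_image_diff_image_cylinder n hw.1 hw0
      rw [hwn] at h3
      calc _ ≤ m (T '' b \ T^[n + 1] '' c ∪ (T^[n + 1] '' (c \ Y') ∪
            T^[n + 1] '' (c \ {x | edist (u x) g < ε}))) := by
            refine measure_mono ?_
            rintro y ⟨hy, hy'⟩
            by_cases hyc : y ∈ T^[n + 1] '' c
            · obtain ⟨x, hx, rfl⟩ := hyc
              right
              by_cases hxY : x ∈ Y'
              · exact Or.inr ⟨x, ⟨hx, fun hxg => hy' ⟨x, ⟨⟨hx, hxg⟩, hxY⟩, rfl⟩⟩, rfl⟩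
              · exact Or.inl ⟨x, ⟨hx, hxY⟩, rfl⟩
            · exact Or.inl ⟨hy, hyc⟩
        _ ≤ 0 + (0 + J * δ) := by
            refine (measure_union_le _ _).trans (add_le_add h3.le ?_)
            exact (measure_union_le _ _).trans (add_le_add h2.le h1)
        _ = J * δ := by simp
    · rintro _ ⟨x, ⟨⟨hx, hxg⟩, hxY, hxΩ, hxf⟩, rfl⟩ _ ⟨y, ⟨⟨hy, hyg⟩, hyY, hyΩ, hyf⟩, rfl⟩
      refine (edist_iterate_le hxf hyf (n + 1)).trans (add_le_add ?_ ?_)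
      · rw [two_mul]
        refine (edist_triangle_right _ _ g).trans (add_le_add hxg.le hyg.le)
      · calc _ ≤ ∑ k ∈ Finset.range (n + 1), (ρ : ℝ≥0∞) ^ (n + 1 - k) * essLip m f (w k) *
              edist (T^[n + 1] x) (T^[n + 1] y) := by
              refine Finset.sum_le_sum fun k hk => ?_
              have hk := Finset.mem_range.1 hk
              refine (hΩ _ (hw.1 k) _ (hxΩ k _ (hw.1 k) (hx k hk)) _
                (hyΩ k _ (hw.1 k) (hy k hk))).trans ?_
              refine (mul_le_mul_right
                (hcontr w hw.1 (n + 1) x ⟨hxY, hx⟩ y ⟨hyY, hy⟩ k hk.le) _).trans_eq ?_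
              ring
          _ ≤ K * edist (T^[n + 1] x) (T^[n + 1] y) := by
              rw [← Finset.sum_mul]
              gcongr
  have hpow : ∀ j : ℕ, (2⁻¹ : ℝ≥0∞) ^ j ≠ 0 := fun j => pow_ne_zero _ (by simp)
  -- The missing measures are summable, so by Borel–Cantelli almost every point of `T '' b` is
  -- eventually in `V j`, where the error `2 * ε` disappears in the limit.
  choose V hVb hVm hV using fun j : ℕ => step (2⁻¹ ^ j) (2⁻¹ ^ j) (hpow j) (hpow j)
  refine essLip_le (Ω := {x | x ∈ T '' b ∧ ∀ᶠ j in Filter.atTop, x ∈ V j}) (fun x hx => hx.1) ?_ ?_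
  · have hsum : ∑' j, m (T '' b \ V j) ≠ ∞ := by
      refine ne_top_of_le_ne_top ?_ (ENNReal.tsum_le_tsum hVm)
      rw [ENNReal.tsum_mul_left, ENNReal.tsum_geometric]
      exact ENNReal.mul_ne_top hJ (by simp)
    refine measure_mono_null ?_ (measure_limsup_atTop_eq_zero hsum)
    rintro x ⟨hx, hx'⟩
    rw [Filter.limsup_eq_iInf_iSup_of_nat]
    simp only [mem_ofPred_eq, hx, true_and, Filter.eventually_atTop, not_exists, not_forall] at hx'
    simp only [iInf_eq_iInter, iSup_eq_iUnion, mem_iInter, mem_iUnion]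
    intro n
    obtain ⟨j, hj, hxj⟩ := hx' n
    exact ⟨j, hj, hx, hxj⟩
  · rintro x ⟨-, hx⟩ y ⟨-, hy⟩
    have hlim : Filter.Tendsto (fun j : ℕ => 2 * (2⁻¹ : ℝ≥0∞) ^ j + K * edist x y) Filter.atTop
        (nhds (2 * 0 + K * edist x y)) :=
      (ENNReal.Tendsto.const_mul (ENNReal.tendsto_pow_atTop_nhds_zero_of_lt_one (by simp))
        (Or.inr (by simp))).add tendsto_const_nhds
    rw [mul_zero, zero_add] at hlim
    refine ge_of_tendsto hlim ?_
    filter_upwards [hx, hy] with j hxj hyj using hV j x hxj y hyj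

/-- The space is almost everywhere separable. -/
theorem exists_isSeparable [BoundedSpace X] [IsProbabilityMeasure m] (hT : IsGibbsMarkov m T α) :
    ∃ Z : Set X, TopologicalSpace.IsSeparable Z ∧ ∀ᵐ x ∂m, x ∈ Z := by
  obtain ⟨ρ, hρ, Y, hY, hcontr⟩ := hT.exists_contraction
  obtain ⟨x₀, b, hb, -⟩ := hT.ae_exists_mem.exists
  refine ⟨{x | x ∈ Y ∧ ∀ k, ∃ a ∈ α, T^[k] x ∈ a}, ?_, hY.and (hT.ae_iterate hT.ae_exists_mem)⟩
  have hdiam : Metric.ediam (univ : Set X) ≠ ∞ :=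
    Metric.isBounded_iff_ediam_ne_top.1 (Bornology.IsBounded.all _)
  suffices h : ∀ ε > 0, ∃ t : Set X, t.Countable ∧
      {x | x ∈ Y ∧ ∀ k, ∃ a ∈ α, T^[k] x ∈ a} ⊆ ⋃ x ∈ t, Metric.closedEBall x ε by
    obtain ⟨t, -, ht, hsub⟩ := EMetric.subset_countable_closure_of_almost_dense_set _ h
    exact ⟨t, ht, hsub⟩
  intro ε hε
  have hlim : Filter.Tendsto (fun n : ℕ => (ρ : ℝ≥0∞) ^ n * Metric.ediam (univ : Set X))
      Filter.atTop (nhds (0 * Metric.ediam (univ : Set X))) :=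
    ENNReal.Tendsto.mul_const (ENNReal.tendsto_pow_atTop_nhds_zero_of_lt_one
      (by exact_mod_cast hρ)) (Or.inr hdiam)
  rw [zero_mul] at hlim
  obtain ⟨n, hn⟩ := (hlim.eventually_lt_const hε).exists
  have : Nonempty X := ⟨x₀⟩
  -- One point per nonempty cylinder gives a countable `ε`-net, since `n` was chosen to make these
  -- cylinders have diameter at most `ε` on `Y`.
  choose! p hp using fun (w : ℕ → Set X) (h : (Y ∩ wordCylinder T w n).Nonempty) => h
  refine ⟨p '' words α b n, (countable_words hT.countable b n).image p, ?_⟩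
  rintro x ⟨hxY, hx⟩
  choose w hwα hw using hx
  set w' : ℕ → Set X := fun k => if k < n then w k else b with hw'
  have hw'α : w' ∈ words α b n := by
    refine ⟨fun k => ?_, fun k hk => if_neg (by omega)⟩
    by_cases hk : k < n <;> simp [hw', hk, hwα, hb]
  have hxw : x ∈ Y ∩ wordCylinder T w' n := ⟨hxY, fun k hk => by simpa [hw', hk] using hw k⟩
  refine mem_biUnion (mem_image_of_mem p hw'α) ?_
  refine (hcontr w' hw'α.1 n x hxw _ (hp w' ⟨x, hxw⟩) 0 (Nat.zero_le _)).trans (le_trans ?_ hn.le)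
  rw [Nat.sub_zero]
  refine mul_le_mul_right ?_ _
  exact Metric.edist_le_ediam_of_mem (s := univ) (mem_univ _) (mem_univ _)

theorem exists_isSeparable_image [BoundedSpace X] [IsProbabilityMeasure m]
    (hT : IsGibbsMarkov m T α) {G : Type*} [MetricSpace G] {f : X → G}
    (hf : ∑' a : α, m a * essLip m f a < ∞) :
    ∃ S : Set G, TopologicalSpace.IsSeparable S ∧ ∀ᵐ x ∂m, f x ∈ S := by
  obtain ⟨Z, hZ, hZae⟩ := hT.exists_isSeparable
  have hex : ∀ a ∈ α, ∃ Ω ⊆ a, m (a \ Ω) = 0 ∧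
      ∀ x ∈ Ω, ∀ y ∈ Ω, edist (f x) (f y) ≤ essLip m f a * edist x y := fun a ha =>
    exists_edist_le_essLip (hT.essLip_ne_top hf ha)
  choose! Ω hΩa hΩ0 hΩ using hex
  have hcount := hT.countable.to_subtype
  refine ⟨⋃ a : α, f '' (Z ∩ Ω a), TopologicalSpace.IsSeparable.iUnion fun a => ?_, ?_⟩
  · have hlip : LipschitzOnWith (essLip m f a).toNNReal f (Z ∩ Ω a) := by
      intro x hx y hy
      rw [ENNReal.coe_toNNReal (hT.essLip_ne_top hf a.2)]
      exact hΩ a a.2 x hx.2 y hy.2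
    exact hlip.continuousOn.isSeparable_image (hZ.mono inter_subset_left)
  · filter_upwards [hZae, hT.ae_exists_mem, hT.ae_mem_of_mem hΩ0] with x hxZ ⟨a, ha, hxa⟩ hx
    exact mem_iUnion.2 ⟨⟨a, ha⟩, x, ⟨hxZ, hx a ha hxa⟩, rfl⟩

omit [MeasurableSpace X] in
-- A separable metric space has at most the cardinality of the continuum: code its points by binary
-- sequences and read these in base three.
theorem _root_.TopologicalSpace.IsSeparable.exists_injOn_real {Z : Set X}
    (hZ : TopologicalSpace.IsSeparable Z) : ∃ ψ : X → ℝ, InjOn ψ Z := by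
  have : TopologicalSpace.SeparableSpace Z := hZ.separableSpace
  have : SecondCountableTopology Z := UniformSpace.secondCountable_of_separable Z
  let _ : MeasurableSpace Z := borel Z
  have : BorelSpace Z := ⟨rfl⟩
  obtain ⟨e, -, he⟩ := MeasurableSpace.measurable_injection_nat_bool_of_countablySeparated Z
  have hinj : Function.Injective fun z : Z => Cardinal.cantorFunction 3⁻¹ (e z) :=
    (Cardinal.cantorFunction_injective (by norm_num) (by norm_num)).comp he
  refine ⟨Function.extend Subtype.val (fun z : Z => Cardinal.cantorFunction 3⁻¹ (e z)) 0, ?_⟩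
  intro x hx y hy hxy
  have h1 := Subtype.val_injective.extend_apply
    (fun z : Z => Cardinal.cantorFunction 3⁻¹ (e z)) 0 ⟨x, hx⟩
  have h2 := Subtype.val_injective.extend_apply
    (fun z : Z => Cardinal.cantorFunction 3⁻¹ (e z)) 0 ⟨y, hy⟩
  exact congrArg Subtype.val (hinj (h1.symm.trans (hxy.trans h2)))

/-- A function whose coboundary is piecewise Lipschitz is almost everywhere separably valued. -/
theorem exists_countable_ae_mem_closure [BoundedSpace X] [BorelSpace X] [IsProbabilityMeasure m]
    (hT : IsGibbsMarkov m T α) (hm : MeasurePreserving T m m) {G : Type*} [NormedAddCommGroup G]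
    [LocallyCompactSpace G] [MeasurableSpace G] [BorelSpace G] {f u : X → G}
    (hf : ∑' a : α, m a * essLip m f a < ∞) (hu : Measurable u)
    (hfu : ∀ᵐ x ∂m, f x = u x - u (T x)) :
    ∃ t : Set G, t.Countable ∧ ∀ᵐ x ∂m, u x ∈ closure t := by
  obtain ⟨Z, hZ, hZae⟩ := hT.exists_isSeparable
  obtain ⟨S, hS, hSae⟩ := hT.exists_isSeparable_image hf
  obtain ⟨C, hC, hC0⟩ := exists_compact_mem_nhds (0 : G)
  obtain ⟨H, hHopen, hHsep, hSH⟩ : ∃ H : AddSubgroup G, IsOpen (H : Set G) ∧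
      TopologicalSpace.IsSeparable (H : Set G) ∧ S ⊆ H := by
    refine ⟨(Submodule.span ℤ (C ∪ S)).toAddSubgroup, ?_, ?_, ?_⟩
    · exact AddSubgroup.isOpen_of_mem_nhds _ (Filter.mem_of_superset hC0
        (subset_union_left.trans Submodule.subset_span))
    · exact (hC.isSeparable.union hS).span (R := ℤ)
    · exact subset_union_right.trans Submodule.subset_span
  have : DiscreteTopology (G ⧸ H) := QuotientAddGroup.discreteTopology hHopen
  obtain ⟨ψ, hψ⟩ := hZ.exists_injOn_real
  have hXne : Nonempty X := ⟨hZae.exists.choose⟩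
  set q : X → G ⧸ H := fun x => (u x : G ⧸ H) with hq
  -- A coset in `q '' Z` is coded by the real label of a chosen point of `Z` above it. The quotient
  -- being discrete, `θ` is continuous however it is chosen, so `θ ∘ q` is measurable.
  set θ : G ⧸ H → ℝ := fun z => ψ (Function.invFunOn q Z z) with hθ
  have hθinj : ∀ x ∈ Z, ∀ y ∈ Z, θ (q x) = θ (q y) → q x = q y := by
    intro x hx y hy h
    have hx' : q x ∈ q '' Z := ⟨x, hx, rfl⟩
    have hy' : q y ∈ q '' Z := ⟨y, hy, rfl⟩
    have h1 := hψ (Function.invFunOn_mem hx') (Function.invFunOn_mem hy') h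
    rw [← Function.invFunOn_eq hx', ← Function.invFunOn_eq hy', h1]
  have hv : Measurable fun x => θ (q x) := by
    have hcont : Continuous fun g : G => θ (g : G ⧸ H) :=
      (continuous_of_discreteTopology (f := θ)).comp QuotientAddGroup.continuous_mk
    exact hcont.measurable.comp hu
  have hzero : ∀ a, essLip m (fun _ : X => (0 : ℝ)) a = 0 := fun a =>
    le_antisymm (essLip_le (Ω := a) subset_rfl (by simp) (by simp)) bot_le
  have hinv : ∀ᵐ x ∂m, (0 : ℝ) = θ (q x) - θ (q (T x)) := by
    filter_upwards [hfu, hSae] with x hx hxS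
    rw [hx] at hxS
    have : q x = q (T x) := by
      rw [hq]
      refine (QuotientAddGroup.eq.2 ?_).symm
      rw [neg_add_eq_sub]
      exact hSH hxS
    rw [this, sub_self]
  obtain ⟨R, -, hR⟩ := hT.exists_essLip_image_le hm
  have hlip : ∀ b ∈ α, essLip m (fun x => θ (q x)) (T '' b) = 0 := by
    intro b hb
    obtain ⟨t, ht, htd⟩ := TopologicalSpace.exists_countable_dense ℝ
    have h := hR ℝ (fun _ => 0) (fun x => θ (q x)) (by simp [hzero]) hv
      ⟨t, ht, by simp [htd.closure_eq]⟩ hinv b hb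
    simpa [hzero] using h
  -- A zero Lipschitz constant makes `θ ∘ q` essentially constant on `T '' b`, and `θ` separates the
  -- cosets reached from `Z`.
  have hcoset : ∀ b ∈ α, ∃ g : G, ∀ᵐ x ∂m, x ∈ T '' b → u x - g ∈ H := by
    intro b hb
    obtain ⟨Ω, hΩb, hΩ0, hΩ⟩ := exists_edist_le_essLip (m := m) (f := fun x => θ (q x))
      (Z := T '' b) (by simp [hlip b hb])
    rcases (Ω ∩ Z).eq_empty_or_nonempty with h | ⟨y, hyΩ, hyZ⟩
    · refine ⟨0, ?_⟩
      filter_upwards [measure_eq_zero_iff_ae_notMem.1 hΩ0, hZae] with x hx hxZ hxb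
      exact (eq_empty_iff_forall_notMem.1 h x
        ⟨by_contra fun hxΩ => hx ⟨hxb, hxΩ⟩, hxZ⟩).elim
    · refine ⟨u y, ?_⟩
      filter_upwards [measure_eq_zero_iff_ae_notMem.1 hΩ0, hZae] with x hx hxZ hxb
      have hxΩ : x ∈ Ω := by
        by_contra hxΩ
        exact hx ⟨hxb, hxΩ⟩
      have h := hΩ y hyΩ x hxΩ
      rw [hlip b hb, zero_mul, nonpos_iff_eq_zero, edist_eq_zero] at h
      have := QuotientAddGroup.eq.1 (hθinj y hyZ x hxZ h)
      rwa [neg_add_eq_sub] at this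
  choose! g hg using hcoset
  obtain ⟨Q, hQ, hHQ⟩ := hHsep
  refine ⟨⋃ b ∈ α, (fun z => z + g b) '' Q, hT.countable.biUnion fun b _ => hQ.image _, ?_⟩
  obtain ⟨s, hsα, -, hs⟩ := hT.bip
  have hcover : ∀ᵐ x ∂m, ∀ a ∈ α, x ∈ a → x ∈ ⋃ b ∈ α, T '' b := by
    refine hT.ae_mem_of_mem (Ω := fun _ => ⋃ b ∈ α, T '' b) fun a ha => ?_
    obtain ⟨b, hb, h0⟩ := (hs a ha).1
    exact measure_mono_null
      (sdiff_subset_sdiff_right (subset_biUnion_of_mem (u := fun b => T '' b) (hsα hb))) h0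
  filter_upwards [hcover, hT.ae_exists_mem, (ae_ball_iff hT.countable).2 hg] with x hx ⟨a, ha, hxa⟩
    hxg
  obtain ⟨b, hb, hxb⟩ := mem_iUnion₂.1 (hx a ha hxa)
  have h1 : u x ∈ (fun z => z + g b) '' closure Q :=
    ⟨u x - g b, hHQ (hxg b hb hxb), sub_add_cancel _ _⟩
  exact closure_mono (subset_biUnion_of_mem (u := fun b => (fun z => z + g b) '' Q) hb)
    (image_closure_subset_closure_image (by fun_prop) h1)

end IsGibbsMarkov

/-! ### From finitely many images to the whole space. -/

theorem theorem1 {X : Type*} [MetricSpace X] [BoundedSpace X] [MeasurableSpace X] [BorelSpace X]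
    (m : Measure X) [IsProbabilityMeasure m] (T : X → X) (α : Set (Set X))
    (hT : IsGibbsMarkov m T α) (hm : MeasurePreserving T m m) :
    ∃ C : ℝ≥0, ∀ (G : Type*) [NormedAddCommGroup G] [LocallyCompactSpace G]
      [MeasurableSpace G] [BorelSpace G] (f u : X → G),
      (∑' a : α, m a * essLip m f a) < ∞ →
      Measurable u →
      (∀ᵐ x ∂m, f x = u x - u (T x)) →
      (⨆ a ∈ imagePartition T α, essLip m u a) < ∞ ∧
      (⨆ a ∈ imagePartition T α, essLip m u a) ≤ C * ∑' a : α, m a * essLip m f a ∧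
      ∃ M : ℝ, ∀ᵐ x ∂m, ‖u x‖ ≤ M := by
  obtain ⟨R, hRt, hR⟩ := hT.exists_essLip_image_le hm
  obtain ⟨s, hsα, hsfin, hs⟩ := hT.bip
  have hcover : ∀ᵐ x ∂m, ∃ b ∈ s, x ∈ T '' b := by
    have h := hT.ae_mem_of_mem (Ω := fun _ => {x | ∃ b ∈ s, x ∈ T '' b}) fun a ha => by
      obtain ⟨b, hb, h0⟩ := (hs a ha).1
      exact measure_mono_null (sdiff_subset_sdiff_right fun x hx => ⟨b, hb, hx⟩) h0
    filter_upwards [h, hT.ae_exists_mem] with x hx ⟨a, ha, hxa⟩ using hx a ha hxa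
  have hRb : ∀ b ∈ s, R / (m b / 2) ≠ ∞ := fun b hb =>
    ENNReal.div_ne_top hRt (by simp [(hT.measure_pos b (hsα hb)).ne'])
  -- Only the finitely many `b ∈ s` are used: `R / (m b / 2)` need not be bounded over `α`.
  refine ⟨∑ b ∈ hsfin.toFinset, (R / (m b / 2)).toNNReal, ?_⟩
  intro G _ _ _ _ f u hf hu hfu
  set C := ∑ b ∈ hsfin.toFinset, (R / (m b / 2)).toNNReal with hC
  set S := ∑' a : α, m a * essLip m f a with hS
  have himage : ∀ b ∈ s, essLip m u (T '' b) ≤ C * S := by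
    intro b hb
    refine (hR G f u hf hu (hT.exists_countable_ae_mem_closure hm hf hu hfu) hfu b
      (hsα hb)).trans ?_
    gcongr
    rw [← ENNReal.coe_toNNReal (hRb b hb), ENNReal.coe_le_coe]
    exact Finset.single_le_sum (f := fun b => (R / (m b / 2)).toNNReal) (fun _ _ => zero_le)
      (hsfin.mem_toFinset.2 hb)
  have hCS : C * S < ∞ := ENNReal.mul_lt_top ENNReal.coe_lt_top hf
  have hsup : (⨆ a ∈ imagePartition T α, essLip m u a) ≤ C * S := by
    refine iSup₂_le ?_
    rintro _ ⟨x, rfl⟩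
    -- An element of the partition is either inside one of the finitely many images or disjoint from
    -- all of them, hence null.
    by_cases hx : ∃ b ∈ s, x ∈ T '' b
    · obtain ⟨b, hb, hxb⟩ := hx
      exact (essLip_mono fun y hy => (hy b (hsα hb)).2 hxb).trans (himage b hb)
    · rw [essLip_eq_zero_of_null]
      · exact zero_le
      · refine measure_mono_null ?_ hcover
        rintro y hy ⟨b, hb, hyb⟩
        exact hx ⟨b, hb, (hy b (hsα hb)).1 hyb⟩
  refine ⟨hsup.trans_lt hCS, hsup, ?_⟩
  have hbound : ∀ b ∈ s, ∃ M : ℝ, 0 ≤ M ∧ ∀ᵐ x ∂m, x ∈ T '' b → ‖u x‖ ≤ M := by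
    intro b hb
    have hL : essLip m u (T '' b) ≠ ∞ := ((himage b hb).trans_lt hCS).ne
    obtain ⟨Ω, -, hΩ0, hΩ⟩ := exists_edist_le_essLip hL
    have hΩae : ∀ᵐ x ∂m, x ∈ T '' b → x ∈ Ω := by
      filter_upwards [measure_eq_zero_iff_ae_notMem.1 hΩ0] with x hx hxb
      by_contra hxΩ
      exact hx ⟨hxb, hxΩ⟩
    rcases Ω.eq_empty_or_nonempty with rfl | ⟨y, hy⟩
    · exact ⟨0, le_rfl, hΩae.mono fun x hx hxb => absurd (hx hxb) (notMem_empty x)⟩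
    · refine ⟨‖u y‖ + (essLip m u (T '' b)).toReal * Metric.diam (univ : Set X),
        by positivity, hΩae.mono fun x hx hxb => ?_⟩
      have h1 : dist (u x) (u y) ≤ (essLip m u (T '' b)).toReal * dist x y := by
        have := ENNReal.toReal_mono (by finiteness) (hΩ x (hx hxb) y hy)
        rwa [ENNReal.toReal_mul, ← dist_edist, ← dist_edist] at this
      have h2 : dist x y ≤ Metric.diam (univ : Set X) :=
        Metric.dist_le_diam_of_mem (Bornology.IsBounded.all _) (mem_univ _) (mem_univ _)
      have h3 : ‖u x‖ ≤ ‖u y‖ + dist (u x) (u y) := by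
        rw [dist_eq_norm]
        exact norm_le_norm_add_norm_sub' _ _
      have h4 := mul_le_mul_of_nonneg_left h2 (ENNReal.toReal_nonneg (a := essLip m u (T '' b)))
      linarith
  choose! M hM0 hM using hbound
  refine ⟨∑ b ∈ hsfin.toFinset, M b, ?_⟩
  filter_upwards [hcover, (ae_ball_iff hsfin.countable).2 hM] with x ⟨b, hb, hxb⟩ hx
  exact (hx b hb hxb).trans (Finset.single_le_sum
    (fun c hc => hM0 c (hsfin.mem_toFinset.1 hc)) (hsfin.mem_toFinset.2 hb))
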